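/- Let $\mathcal M=(M;\oplus,\neg,0)$ be an MV-algebra; put $1=\neg 0$, $x\odot y=\neg(\neg x\oplus\neg y)$, $x\to y=\neg x\oplus y$, and $x\le y$ iff $x\to y=1$. Let $[0,1]$ be the standard MV-algebra, with $x\oplus y=\min(1,x+y)$ and $\neg x=1-x$; powers of it carry the componentwise operations. Assume that $\mathcal M$ has an order reflecting set of MV-morphisms into $[0,1]$, i.e. a set $S_0$ of MV-morphisms $s:\mathcal M\to[0,1]$ such that, for all $a,b\in M$, $a\le b$ whenever $s(a)\le s(b)$ for all $s\in S_0$. Let $G,H:M\to M$ be q-tense operators on $\mathcal M$: with $P(x)=\neg H(\neg x)$, one has $P(x)\le y\iff x\le G(y)$ for all $x,y\in M$, and both $P$ and $G$ commute with the unary operations $x\mapsto x\oplus x$ and $x\mapsto x\odot x$. Let $S$ be the set of all MV-morphisms $\mathcal M\to[0,1]$ (it is non-empty if $0\ne1$ in $M$), and define a relation $R_G$ on $S$ by $$s\,R_G\,t\iff s(G(x))\le t(x)\text{ for all }x\in M .$$ For $p\in[0,1]^S$ and $s\in S$ put $$G^*(p)(s)=\bigwedge\{p(t)\mid t\in S,\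 s\,R_G\,t\},\qquad H^*(p)(s)=\bigwedge\{p(t)\mid t\in S,\ t\,R_G\,s\},$$ where $\bigwedge\emptyset=1$. Then $G^*$ and $H^*$ are q-tense operators on $[0,1]^S$ as well as tense operators in the sense of Diaconescu and Georgescu, and $x\mapsto(s(x))_{s\in S}$ is an embedding of $(\mathcal M,G,H)$ into the tense MV-algebra $([0,1]^S,G^*,H^*)$, i.e. an injective order reflecting MV-morphism $i$ with $i(G(x))=G^*(i(x))$ and $i(H(x))=H^*(i(x))$ for all $x\in M$. In particular, $G$ and $H$ are tense operators on $\mathcal M$ in the sense of Diaconescu and Georgescu: with $F(x)=\neg G(\neg x)$ and $P(x)=\neg H(\neg x)$, for all $x,y\in M$, $G(1)=H(1)=1$; $G(x\to y)\le G(x)\to G(y)$ and $H(x\to y)\le H(x)\to H(y)$; $G(x)\oplus G(y)\le G(x\oplus y)$ and $H(x)\oplus H(y)\le H(x\oplus y)$; $G(x\oplus x)\le G(x)\oplus G(x)$ and $H(x\oplus x)\le H(x)\oplus H(x)$; $F(x)\oplus F(x)\le F(x\oplus x)$ and $P(x)\oplus P(x)\le P(x\oplus x)$; $x\le G(P(x))$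 and $x\le H(F(x))$. -/

import Mathlib

open scoped unitInterval

universe u v

/-- An MV-algebra `(M; ⊕, ¬, 0)`, together with its natural order. The order is not additional
data: `le_iff` pins it down as `x ≤ y ↔ ¬x ⊕ y = 1`, where `1 = ¬0`, and for every MV-algebra
this relation is a partial order. It is bundled so that on `[0,1]` and on powers of `[0,1]` the
natural order is literally the usual one. -/
class MVAlgebra (M : Type u) extends PartialOrder M where
  oplus : M → M → M
  neg : M → M
  zero : M
  oplus_assoc : ∀ x y z, oplus (oplus x y) z = oplus x (oplus y z)
  oplus_comm : ∀ x y, oplus x y = oplus y x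
  oplus_zero : ∀ x, oplus x zero = x
  neg_neg : ∀ x, neg (neg x) = x
  oplus_neg_zero : ∀ x, oplus x (neg zero) = neg zero
  lukasiewicz : ∀ x y, oplus (neg (oplus (neg x) y)) y = oplus (neg (oplus (neg y) x)) x
  le_iff : ∀ x y, x ≤ y ↔ oplus (neg x) y = neg zero

namespace MVAlgebra

/-- The top element `1 = ¬0`. -/
def one {M : Type u} [MVAlgebra M] : M := neg zero

/-- `x ⊙ y = ¬(¬x ⊕ ¬y)`. -/
def odot {M : Type u} [MVAlgebra M] (x y : M) : M := neg (oplus (neg x) (neg y))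

/-- `x → y = ¬x ⊕ y`. -/
def imp {M : Type u} [MVAlgebra M] (x y : M) : M := oplus (neg x) y

/-- The unary operation `q x = x ⊕ x`. -/
def q {M : Type u} [MVAlgebra M] (x : M) : M := oplus x x

/-- The unary operation `d x = x ⊙ x`. -/
def d {M : Type u} [MVAlgebra M] (x : M) : M := odot x x

/-- The operator `¬ ∘ K ∘ ¬` (it gives `P` from `H` and `F` from `G`). -/
def dual {M : Type u} [MVAlgebra M] (K : M → M) (x : M) : M := neg (K (neg x))

/-- The standard MV-algebra `[0,1]`: `x ⊕ y = min 1 (x + y)`, `¬x = 1 - x`, usual order. -/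
noncomputable instance instUnitInterval : MVAlgebra I where
  toPartialOrder := inferInstance
  oplus x y := ⟨min 1 ((x : ℝ) + y), le_min zero_le_one (add_nonneg x.2.1 y.2.1), min_le_left _ _⟩
  neg x := σ x
  zero := 0
  oplus_assoc x y z := by
    have hx := x.2.1
    have hz := z.2.1
    apply Subtype.ext
    simp only
    rcases min_cases (1 : ℝ) ((x : ℝ) + y) with h | h <;>
    rcases min_cases (1 : ℝ) ((y : ℝ) + z) with h' | h' <;>
    rw [h.1, h'.1] <;> grind
  oplus_comm x y := by
    apply Subtype.ext
    simp only [add_comm]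
  oplus_zero x := by
    apply Subtype.ext
    simpa using x.2.2
  neg_neg x := unitInterval.symm_symm x
  oplus_neg_zero x := by
    apply Subtype.ext
    simpa using x.2.1
  lukasiewicz x y := by
    apply Subtype.ext
    simp only [unitInterval.coe_symm_eq]
    have hx := x.2
    have hy := y.2
    simp only [Set.mem_Icc] at hx hy
    grind
  le_iff x y := by
    rw [Subtype.ext_iff, ← Subtype.coe_le_coe]
    simp only [unitInterval.coe_symm_eq, unitInterval.symm_zero, Set.Icc.coe_one]
    grind

/-- The direct power `M^T` with the componentwise operations and order. -/
instance instPi {T : Type v} {M : Type u} [MVAlgebra M] : MVAlgebra (T → M) where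
  toPartialOrder := inferInstance
  oplus p r := fun t => oplus (p t) (r t)
  neg p := fun t => neg (p t)
  zero := fun _ => zero
  oplus_assoc p r w := funext fun t => oplus_assoc (p t) (r t) (w t)
  oplus_comm p r := funext fun t => oplus_comm (p t) (r t)
  oplus_zero p := funext fun t => oplus_zero (p t)
  neg_neg p := funext fun t => neg_neg (p t)
  oplus_neg_zero p := funext fun t => oplus_neg_zero (p t)
  lukasiewicz p r := funext fun t => lukasiewicz (p t) (r t)
  le_iff p r := by
    rw [Pi.le_def, funext_iff]
    exact forall_congr' fun t => le_iff (p t) (r t)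

end MVAlgebra

open MVAlgebra in
/-- `f` is a morphism of MV-algebras. -/
structure IsMVMorphism {M : Type u} {N : Type v} [MVAlgebra M] [MVAlgebra N] (f : M → N) :
    Prop where
  map_oplus : ∀ x y, f (oplus x y) = oplus (f x) (f y)
  map_neg : ∀ x, f (neg x) = neg (f x)
  map_zero : f zero = zero

/-- The set of all MV-morphisms from `M` into the standard MV-algebra `[0,1]`. -/
def standardMorphisms (M : Type u) [MVAlgebra M] : Set (M → I) := {s | IsMVMorphism s}

/-- `S` is an order reflecting set of MV-morphisms from `M` into `[0,1]`. -/
structure IsOrderReflecting {M : Type u} [MVAlgebra M] (S : Set (M → I)) : Prop where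
  morphism : S ⊆ standardMorphisms M
  reflects : ∀ a b : M, (∀ s ∈ S, s a ≤ s b) → a ≤ b

open MVAlgebra in
/-- `(f, g)` is a Galois q-connection between `A` and `B`. -/
structure IsGaloisQConnection {A : Type u} {B : Type v} [MVAlgebra A] [MVAlgebra B]
    (f : A → B) (g : B → A) : Prop where
  galois : GaloisConnection f g
  map_q_left : ∀ x, f (q x) = q (f x)
  map_d_left : ∀ x, f (d x) = d (f x)
  map_q_right : ∀ y, g (q y) = q (g y)
  map_d_right : ∀ y, g (d y) = d (g y)

/-- `G` and `H` are q-tense operators: `(P, G)` is a Galois q-connection, where `P = ¬ ∘ H ∘ ¬`. -/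
def IsQTense {M : Type u} [MVAlgebra M] (G H : M → M) : Prop :=
  IsGaloisQConnection (MVAlgebra.dual H) G

open MVAlgebra in
/-- `G` and `H` are tense operators on the MV-algebra `M` in the sense of Diaconescu and Georgescu,
i.e. `(M, G, H)` is a tense MV-algebra; here `F = ¬ ∘ G ∘ ¬` and `P = ¬ ∘ H ∘ ¬`. -/
structure IsTense {M : Type u} [MVAlgebra M] (G H : M → M) : Prop where
  G_one : G one = one
  H_one : H one = one
  G_imp : ∀ x y, G (imp x y) ≤ imp (G x) (G y)
  H_imp : ∀ x y, H (imp x y) ≤ imp (H x) (H y)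
  G_oplus : ∀ x y, oplus (G x) (G y) ≤ G (oplus x y)
  H_oplus : ∀ x y, oplus (H x) (H y) ≤ H (oplus x y)
  G_double : ∀ x, G (oplus x x) ≤ oplus (G x) (G x)
  H_double : ∀ x, H (oplus x x) ≤ oplus (H x) (H x)
  F_double : ∀ x, oplus (dual G x) (dual G x) ≤ dual G (oplus x x)
  P_double : ∀ x, oplus (dual H x) (dual H x) ≤ dual H (oplus x x)
  le_G_P : ∀ x, x ≤ G (dual H x)
  le_H_F : ∀ x, x ≤ H (dual G x)

/-- The operator `G*` on `[0,1]^T` induced by `(T, R)`: `G* p s = ⋀ {p t | s R t}`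
(the meet of the empty family is `1`). -/
noncomputable def frameG {T : Type u} (R : T → T → Prop) (p : T → I) (s : T) : I :=
  sInf {a | ∃ t, R s t ∧ a = p t}

/-- The operator `H*` on `[0,1]^T` induced by `(T, R)`: `H* p s = ⋀ {p t | t R s}`. -/
noncomputable def frameH {T : Type u} (R : T → T → Prop) (p : T → I) (s : T) : I :=
  sInf {a | ∃ t, R t s ∧ a = p t}

/-- The relation `R_G` on the set of all MV-morphisms `M → [0,1]`:
`s R_G t` iff `s (G x) ≤ t x` for all `x`. -/
def relG {M : Type u} [MVAlgebra M] (G : M → M) (s t : standardMorphisms M) : Prop :=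
  ∀ x : M, s.1 (G x) ≤ t.1 x

/-- The evaluation map `M → [0,1]^S`, `x ↦ (s x)_{s ∈ S}`, for `S` the set of all MV-morphisms. -/
def evalMap (M : Type u) [MVAlgebra M] (x : M) (s : standardMorphisms M) : I := s.1 x

/-- `e` is an embedding of the MV-algebra with operators `(M, G, H)` into `(N, G', H')`:
an injective, order reflecting MV-morphism that carries `G` to `G'` and `H` to `H'`. -/
structure IsTenseEmbedding {M : Type u} {N : Type v} [MVAlgebra M] [MVAlgebra N]
    (G H : M → M) (G' H' : N → N) (e : M → N) : Prop where
  morphism : IsMVMorphism e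
  injective : Function.Injective e
  le_iff_le : ∀ a b, e a ≤ e b ↔ a ≤ b
  map_G : ∀ x, e (G x) = G' (e x)
  map_H : ∀ x, e (H x) = H' (e x)

/-!
Everything rests on two facts.

*Dyadic separation* (`exists_dyadicTerm`). For `a < b` in `[0,1]` some composition `τ` of
`q x = x ⊕ x` and `d x = x ⊙ x` has `τ a = 0` and `τ b = 1`. Since such compositions commute both
with morphisms and with `q`-tense operators, they translate inequalities between real numbers into
statements about elements of `M`.

*Extension of semistates* (`IsSemistate.exists_morphism`). Let `k = s ∘ G` for a morphism `s`; it is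
monotone, preserves `1` and binary meets, and commutes with `q` and `d`. If `k x < r`, there is a
morphism `t ≥ k` with `t x ≤ r`. The morphisms form a closed subset of the compact space
`[0,1]^M`, so it suffices to find, for finitely many `c i < k (y i)`, a morphism `t` with
`c i ≤ t (y i)` and `t x ≤ r`. Let `m` be the meet of elements `τ i (y i)`, where `τ i` separates
`c i` from `k (y i)`; then `k m = 1`. Let `τ` separate `k x` from `r`. If none of the order
reflecting morphisms were suitable, each of them would send `m` to `0` or `τ x` to `1`, whence
`m ≤ τ x` and `1 = k m ≤ τ (k x) = 0`.

Consequently `s (G x)` is the infimum of the `t x` over all `t` with `s R_G t`, which says that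
evaluation carries `G` to `G*`. The situation is symmetric: `(H, G)` is again a pair of `q`-tense
operators and `R_H` is the converse of `R_G`, so `H` is carried to `H*`. The operators of a frame
satisfy the tense identities by computation with infima in `[0,1]`, and these identities are
reflected by the embedding.
-/

open MVAlgebra

/-! ### General MV-algebras -/

namespace MVAlgebra

section General

variable {M : Type u} [MVAlgebra M]

theorem neg_le_neg_iff' {x y : M} : neg x ≤ neg y ↔ y ≤ x := by
  rw [le_iff, le_iff, MVAlgebra.neg_neg, oplus_comm]

theorem neg_le_comm' {x y : M} : neg x ≤ y ↔ neg y ≤ x := by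
  rw [← neg_le_neg_iff', MVAlgebra.neg_neg]

theorem le_neg_comm' {x y : M} : x ≤ neg y ↔ y ≤ neg x := by
  rw [← neg_le_neg_iff', MVAlgebra.neg_neg]

theorem le_one' (x : M) : x ≤ one := (le_iff x one).2 (oplus_neg_zero _)

theorem neg_q (x : M) : neg (q x) = d (neg x) := by
  simp only [q, d, odot, MVAlgebra.neg_neg]

theorem neg_d (x : M) : neg (d x) = q (neg x) := by
  simp only [q, d, odot, MVAlgebra.neg_neg]

theorem dual_q {K : M → M} (hK : ∀ x, K (d x) = d (K x)) (x : M) :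
    dual K (q x) = q (dual K x) := by
  simp only [dual, neg_q, hK, neg_d]

theorem dual_d {K : M → M} (hK : ∀ x, K (q x) = q (K x)) (x : M) :
    dual K (d x) = d (dual K x) := by
  simp only [dual, neg_q, hK, neg_d]

theorem dual_dual (K : M → M) : dual (dual K) = K := by
  funext x
  simp only [dual, MVAlgebra.neg_neg]

/-- The lattice meet `x ⊙ (x → y)` of an MV-algebra. -/
def meet (x y : M) : M := odot x (imp x y)

/-- The unary term operation given by a word in `q` (letter `true`) and `d` (letter `false`);
the head of the list is applied first. -/
def dyadicTerm : List Bool → M → M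
  | [], x => x
  | true :: l, x => dyadicTerm l (q x)
  | false :: l, x => dyadicTerm l (d x)

theorem map_dyadicTerm {N : Type v} [MVAlgebra N] {f : M → N} (hq : ∀ x, f (q x) = q (f x))
    (hd : ∀ x, f (d x) = d (f x)) (l : List Bool) (x : M) :
    f (dyadicTerm l x) = dyadicTerm l (f x) := by
  induction l generalizing x with
  | nil => rfl
  | cons b l ih => cases b <;> simp only [dyadicTerm, ih, hq, hd]

end General

/-! ### The standard MV-algebra and dyadic separation -/

theorem coe_oplus (x y : I) : ((oplus x y : I) : ℝ) = min 1 ((x : ℝ) + y) := rfl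

theorem coe_neg (x : I) : ((neg x : I) : ℝ) = 1 - x := rfl

theorem one_eq : (one : I) = 1 := unitInterval.symm_zero

theorem coe_odot (x y : I) : ((odot x y : I) : ℝ) = max 0 ((x : ℝ) + y - 1) := by
  simp only [odot, coe_neg, coe_oplus]
  grind

theorem coe_imp (x y : I) : ((imp x y : I) : ℝ) = min 1 (1 - (x : ℝ) + y) := rfl

theorem coe_q (x : I) : ((q x : I) : ℝ) = min 1 ((x : ℝ) + x) := rfl

theorem coe_d (x : I) : ((d x : I) : ℝ) = max 0 ((x : ℝ) + x - 1) := coe_odot x x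

theorem meet_eq_min (x y : I) : meet x y = min x y := by
  apply Subtype.ext
  have hx := x.2
  have hy := y.2
  simp only [Set.mem_Icc] at hx hy
  simp only [meet, coe_odot, coe_imp]
  rcases le_total x y with h | h
  · rw [min_eq_left h]
    rw [← Subtype.coe_le_coe] at h
    grind
  · rw [min_eq_right h]
    rw [← Subtype.coe_le_coe] at h
    grind

theorem q_mono : Monotone (q : I → I) := by
  intro x y h
  rw [← Subtype.coe_le_coe] at h ⊢
  simp only [coe_q]
  grind

theorem d_mono : Monotone (d : I → I) := by
  intro x y h
  rw [← Subtype.coe_le_coe] at h ⊢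
  simp only [coe_d]
  grind

theorem continuous_oplus : Continuous fun p : I × I => oplus p.1 p.2 :=
  Continuous.subtype_mk (by fun_prop) _

theorem continuous_neg : Continuous (neg : I → I) := unitInterval.continuous_symm

theorem continuous_q : Continuous (q : I → I) :=
  continuous_oplus.comp (continuous_id.prodMk continuous_id)

theorem continuous_d : Continuous (d : I → I) := by
  have h : (d : I → I) = fun x => neg (q (neg x)) := by
    funext x
    rw [neg_q, MVAlgebra.neg_neg]
  rw [h]
  exact continuous_neg.comp (continuous_q.comp continuous_neg)

theorem q_one : q (1 : I) = 1 := by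
  apply Subtype.ext
  simp [coe_q]

theorem d_one : d (1 : I) = 1 := by
  apply Subtype.ext
  simp [coe_d]

theorem dyadicTerm_mono (l : List Bool) : Monotone (dyadicTerm l : I → I) := by
  induction l with
  | nil => exact monotone_id
  | cons b l ih =>
    cases b
    · exact ih.comp d_mono
    · exact ih.comp q_mono

/-- Iterating `q` fixes `0` and moves any positive number to `1`. -/
theorem exists_dyadicTerm_zero {b : I} (hb : 0 < b) :
    ∃ l : List Bool, dyadicTerm l (0 : I) = 0 ∧ dyadicTerm l b = 1 := by
  have q0 : q (0 : I) = 0 := Subtype.ext (by simp [coe_q])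
  obtain ⟨n, hn⟩ := pow_unbounded_of_one_lt (1 / (b : ℝ)) (one_lt_two : (1 : ℝ) < 2)
  rw [div_lt_iff₀ (Subtype.coe_lt_coe.2 hb)] at hn
  clear hb
  induction n generalizing b with
  | zero =>
    have := b.2.2
    simp at hn
    linarith
  | succ n ih =>
    by_cases h : (b : ℝ) ≤ 1 / 2
    · obtain ⟨l, h0, h1⟩ := ih (b := q b) (by
        rw [coe_q, min_eq_right (by linarith)]
        rw [pow_succ] at hn
        linarith)
      exact ⟨true :: l, by simpa only [dyadicTerm, q0] using h0, h1⟩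
    · have hb1 : q b = 1 := Subtype.ext (by
        rw [coe_q, min_eq_left (by linarith)]; rfl)
      exact ⟨[true], q0, hb1⟩

/-- Two distinct points of `[0,1]` are pulled apart to `0` and `1` by iterated doubling: as long as
both lie in the same half, `q` or `d` doubles their distance, and once they lie in different
halves, `d` sends the smaller one to `0`, after which iterating `q` suffices. -/
theorem exists_dyadicTerm {a b : I} (hab : a < b) :
    ∃ l : List Bool, dyadicTerm l a = 0 ∧ dyadicTerm l b = 1 := by
  obtain ⟨n, hn⟩ := pow_unbounded_of_one_lt (1 / ((b : ℝ) - a)) (one_lt_two : (1 : ℝ) < 2)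
  rw [div_lt_iff₀ (sub_pos.2 (Subtype.coe_lt_coe.2 hab))] at hn
  induction n generalizing a b with
  | zero =>
    have := b.2.2
    have := a.2.1
    simp at hn
    linarith
  | succ n ih =>
    rw [pow_succ] at hn
    have hab' : (a : ℝ) < b := hab
    by_cases hb : (b : ℝ) ≤ 1 / 2
    · have ha' : ((q a : I) : ℝ) = a + a := by rw [coe_q, min_eq_right (by linarith)]
      have hb' : ((q b : I) : ℝ) = b + b := by rw [coe_q, min_eq_right (by linarith)]
      obtain ⟨l, h0, h1⟩ := ih (a := q a) (b := q b)
        (Subtype.coe_lt_coe.1 (by linarith)) (by rw [ha', hb']; linarith)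
      exact ⟨true :: l, h0, h1⟩
    · have hb' : ((d b : I) : ℝ) = b + b - 1 := by rw [coe_d, max_eq_right (by linarith)]
      by_cases ha : (a : ℝ) ≤ 1 / 2
      · have ha' : d a = 0 := Subtype.ext (by rw [coe_d, max_eq_left (by linarith)]; rfl)
        obtain ⟨l, h0, h1⟩ := exists_dyadicTerm_zero (b := d b)
          (Subtype.coe_lt_coe.1 (by rw [hb']; push_cast; linarith))
        exact ⟨false :: l, by simpa only [dyadicTerm, ha'] using h0, h1⟩
      · have ha' : ((d a : I) : ℝ) = a + a - 1 := by rw [coe_d, max_eq_right (by linarith)]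
        obtain ⟨l, h0, h1⟩ := ih (a := d a) (b := d b)
          (Subtype.coe_lt_coe.1 (by linarith)) (by rw [ha', hb']; linarith)
        exact ⟨false :: l, h0, h1⟩

end MVAlgebra

/-! ### Morphisms into the standard MV-algebra -/

namespace IsMVMorphism

variable {M : Type u} {N : Type v} [MVAlgebra M] [MVAlgebra N] {f : M → N}

theorem map_one (hf : IsMVMorphism f) : f one = one := by
  simp only [one, hf.map_neg, hf.map_zero]

theorem map_odot (hf : IsMVMorphism f) (x y : M) : f (odot x y) = odot (f x) (f y) := by
  simp only [odot, hf.map_neg, hf.map_oplus]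

theorem map_imp (hf : IsMVMorphism f) (x y : M) : f (imp x y) = imp (f x) (f y) := by
  simp only [imp, hf.map_neg, hf.map_oplus]

theorem map_q (hf : IsMVMorphism f) (x : M) : f (q x) = q (f x) := hf.map_oplus x x

theorem map_d (hf : IsMVMorphism f) (x : M) : f (d x) = d (f x) := hf.map_odot x x

theorem map_meet (hf : IsMVMorphism f) (x y : M) : f (meet x y) = meet (f x) (f y) := by
  simp only [meet, hf.map_odot, hf.map_imp]

theorem monotone (hf : IsMVMorphism f) : Monotone f := by
  intro x y h
  rw [le_iff] at h ⊢
  rw [← hf.map_neg, ← hf.map_oplus, h, hf.map_neg, hf.map_zero]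

end IsMVMorphism

theorem isClosed_standardMorphisms (M : Type u) [MVAlgebra M] :
    IsClosed (standardMorphisms M) := by
  have h : standardMorphisms M =
      (⋂ x : M, ⋂ y : M, {s : M → I | s (oplus x y) = oplus (s x) (s y)}) ∩
      ((⋂ x : M, {s : M → I | s (neg x) = neg (s x)}) ∩ {s : M → I | s zero = zero}) := by
    ext s
    simp only [standardMorphisms, Set.mem_inter_iff, Set.mem_iInter, Set.mem_ofPred_eq]
    exact ⟨fun h => ⟨h.1, h.2, h.3⟩, fun h => ⟨h.1, h.2.1, h.2.2⟩⟩
  rw [h]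
  refine (isClosed_iInter fun x => isClosed_iInter fun y =>
      isClosed_eq (continuous_apply _) ?_).inter
    ((isClosed_iInter fun x => isClosed_eq (continuous_apply _) ?_).inter
      (isClosed_eq (continuous_apply _) continuous_const))
  · exact continuous_oplus.comp (f := fun s : M → I => (s x, s y)) ((continuous_apply x).prodMk (continuous_apply y))
  · exact continuous_neg.comp (continuous_apply x)

namespace IsOrderReflecting

variable {M : Type u} [MVAlgebra M] {S₀ : Set (M → I)}

theorem meet_le_left (hS : IsOrderReflecting S₀) (x y : M) : meet x y ≤ x :=
  hS.reflects _ _ fun s hs => by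
    rw [(hS.morphism hs).map_meet, meet_eq_min]
    exact min_le_left _ _

theorem meet_le_right (hS : IsOrderReflecting S₀) (x y : M) : meet x y ≤ y :=
  hS.reflects _ _ fun s hs => by
    rw [(hS.morphism hs).map_meet, meet_eq_min]
    exact min_le_right _ _

theorem le_meet (hS : IsOrderReflecting S₀) {x y z : M} (hx : z ≤ x) (hy : z ≤ y) :
    z ≤ meet x y :=
  hS.reflects _ _ fun s hs => by
    have hs' : IsMVMorphism s := hS.morphism hs
    rw [hs'.map_meet, meet_eq_min]
    exact le_min (hs'.monotone hx) (hs'.monotone hy)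

end IsOrderReflecting

/-! ### Extension of semistates to morphisms -/

/-- A map `k : M → [0,1]` that is monotone, preserves `1` and binary meets, and commutes with
`x ↦ x ⊕ x` and `x ↦ x ⊙ x`. Half of the preservation of meets is implied by monotonicity and
therefore omitted. -/
structure IsSemistate {M : Type u} [MVAlgebra M] (k : M → I) : Prop where
  monotone : Monotone k
  map_one : k one = 1
  min_le_meet : ∀ x y, min (k x) (k y) ≤ k (meet x y)
  map_q : ∀ x, k (q x) = q (k x)
  map_d : ∀ x, k (d x) = d (k x)

namespace IsSemistate

variable {M : Type u} [MVAlgebra M] {k : M → I}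

/-- Finitely many bounds `c < k y` are witnessed by a single element `m` with `k m = 1`. -/
theorem exists_witness (hk : IsSemistate k) (u : Finset {p : M × I // p.2 < k p.1}) :
    ∃ m, k m = 1 ∧ ∀ p ∈ u, ∀ t ∈ standardMorphisms M, 0 < t m → p.1.2 ≤ t p.1.1 := by
  classical
  induction u using Finset.induction_on with
  | empty => exact ⟨one, hk.map_one, by simp⟩
  | insert p u _ ih =>
    obtain ⟨m, hm, hmu⟩ := ih
    obtain ⟨l, h0, h1⟩ := exists_dyadicTerm p.2
    refine ⟨meet (dyadicTerm l p.1.1) m, le_antisymm unitInterval.le_one' ?_, ?_⟩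
    · refine le_trans (le_min ?_ hm.ge) (hk.min_le_meet _ _)
      rw [map_dyadicTerm hk.map_q hk.map_d, h1]
    · intro p' hp' t ht htm
      have ht' : IsMVMorphism t := ht
      rw [ht'.map_meet, meet_eq_min, lt_min_iff] at htm
      rcases Finset.mem_insert.1 hp' with rfl | hp'
      · by_contra hlt
        have := dyadicTerm_mono l (not_le.1 hlt).le
        rw [h0, ← map_dyadicTerm ht'.map_q ht'.map_d] at this
        exact absurd htm.1 (not_lt.2 this)
      · exact hmu p' hp' t ht htm.2

/-- A semistate on an algebra with an order reflecting set of morphisms into `[0,1]` is the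
pointwise infimum of the morphisms above it. -/
theorem exists_morphism {S₀ : Set (M → I)} (hS : IsOrderReflecting S₀) (hk : IsSemistate k)
    {x : M} {r : I} (hr : k x < r) :
    ∃ t ∈ standardMorphisms M, (∀ y, k y ≤ t y) ∧ t x ≤ r := by
  have hK : IsCompact (standardMorphisms M ∩ {t | t x ≤ r}) :=
    ((isClosed_standardMorphisms M).inter
      (isClosed_le (continuous_apply x) continuous_const)).isCompact
  obtain ⟨t, ⟨ht, htx⟩, htC⟩ := hK.inter_iInter_nonempty
    (fun p : {p : M × I // p.2 < k p.1} => {t : M → I | p.1.2 ≤ t p.1.1})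
    (fun p => isClosed_le continuous_const (continuous_apply _)) (fun u => by
      obtain ⟨m, hm, hmu⟩ := hk.exists_witness u
      obtain ⟨l, h0, h1⟩ := exists_dyadicTerm hr
      by_contra hne
      have hle : m ≤ dyadicTerm l x := hS.reflects _ _ fun s hs => by
        have hs' : IsMVMorphism s := hS.morphism hs
        rcases eq_or_ne (s m) 0 with hsm | hsm
        · rw [hsm]
          exact unitInterval.nonneg'
        · have hsx : r ≤ s x := by
            by_contra hlt
            exact hne ⟨s, ⟨hS.morphism hs, (not_le.1 hlt).le⟩, Set.mem_iInter₂.2 fun p hp =>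
              hmu p hp s (hS.morphism hs) (unitInterval.pos_iff_ne_zero.2 hsm)⟩
          have := dyadicTerm_mono l hsx
          rw [h1, ← map_dyadicTerm hs'.map_q hs'.map_d] at this
          exact unitInterval.le_one'.trans this
      have := hk.monotone hle
      rw [hm, map_dyadicTerm hk.map_q hk.map_d, h0] at this
      exact absurd this (not_le.2 zero_lt_one))
  rw [Set.mem_iInter] at htC
  exact ⟨t, ht, fun y => le_of_forall_lt_imp_le_of_dense fun c hc => htC ⟨(y, c), hc⟩, htx⟩

end IsSemistate

/-! ### Tense operators of a frame -/

section Frame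

variable {T : Type u} (R : T → T → Prop)

theorem frameG_le {p : T → I} {s t : T} (h : R s t) : frameG R p s ≤ p t :=
  sInf_le ⟨t, h, rfl⟩

theorem le_frameG {p : T → I} {s : T} {a : I} (h : ∀ t, R s t → a ≤ p t) : a ≤ frameG R p s :=
  le_sInf fun _ ⟨t, ht, hb⟩ => hb ▸ h t ht

/-- The hypothesis `f 1 = 1` is needed at points without successors, where the meet is empty. -/
theorem frameG_comp {f : I → I} (hc : Continuous f) (hm : Monotone f) (h1 : f 1 = 1)
    (p : T → I) (s : T) : frameG R (fun t => f (p t)) s = f (frameG R p s) := by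
  unfold frameG
  rw [hm.map_sInf_of_continuousAt hc.continuousAt h1]
  congr 1
  ext a
  constructor
  · rintro ⟨t, ht, rfl⟩
    exact ⟨_, ⟨t, ht, rfl⟩, rfl⟩
  · rintro ⟨_, ⟨t, ht, rfl⟩, rfl⟩
    exact ⟨t, ht, rfl⟩

theorem frameG_q (p : T → I) : frameG R (q p) = q (frameG R p) :=
  funext fun s => frameG_comp R continuous_q q_mono q_one p s

theorem frameG_d (p : T → I) : frameG R (d p) = d (frameG R p) :=
  funext fun s => frameG_comp R continuous_d d_mono d_one p s

theorem frameG_one : frameG R one = one := by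
  refine le_antisymm (le_one' _) fun s => le_frameG R fun t _ => le_rfl

theorem frameG_imp (x y : T → I) : frameG R (imp x y) ≤ imp (frameG R x) (frameG R y) := by
  intro s
  change frameG R (imp x y) s ≤ imp (frameG R x s) (frameG R y s)
  have h : odot (frameG R (imp x y) s) (frameG R x s) ≤ frameG R y s := by
    refine le_frameG R fun t ht => ?_
    have h1 : frameG R (imp x y) s ≤ imp (x t) (y t) := frameG_le R ht
    have h2 := frameG_le R (p := x) ht
    have h3 := (y t).2.1
    rw [← Subtype.coe_le_coe] at h1 h2 ⊢
    rw [coe_imp] at h1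
    rw [coe_odot]
    grind
  have h1 := (frameG R (imp x y) s).2.2
  rw [← Subtype.coe_le_coe] at h ⊢
  rw [coe_odot] at h
  rw [coe_imp]
  grind

theorem frameG_oplus (x y : T → I) :
    oplus (frameG R x) (frameG R y) ≤ frameG R (oplus x y) := by
  intro s
  refine le_frameG R fun t ht => ?_
  change oplus (frameG R x s) (frameG R y s) ≤ oplus (x t) (y t)
  have h1 := frameG_le R (p := x) ht
  have h2 := frameG_le R (p := y) ht
  rw [← Subtype.coe_le_coe] at h1 h2 ⊢
  rw [coe_oplus, coe_oplus]
  grind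

/-- `H*` is `G*` for the converse relation. -/
theorem frameH_eq : frameH R = frameG (fun s t => R t s) := rfl

theorem frame_galois : GaloisConnection (dual (frameH R)) (frameG R) := by
  intro p r
  simp only [frameH_eq]
  constructor
  · intro h s
    refine le_frameG R fun t ht => ?_
    have h1 : neg (frameG (fun s t => R t s) (neg p) t) ≤ r t := h t
    have h2 : frameG (fun s t => R t s) (neg p) t ≤ neg (p s) := frameG_le (fun s t => R t s) ht
    exact (le_neg_comm'.1 h2).trans h1
  · intro h t
    change neg (frameG (fun s t => R t s) (neg p) t) ≤ r t
    rw [neg_le_comm']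
    refine le_frameG (fun s t => R t s) fun s hs => ?_
    exact neg_le_neg_iff'.2 ((h s).trans (frameG_le R hs))

theorem frame_isQTense : IsQTense (frameG R) (frameH R) where
  galois := frame_galois R
  map_q_left := dual_q (frameG_d _)
  map_d_left := dual_d (frameG_q _)
  map_q_right := frameG_q R
  map_d_right := frameG_d R

end Frame

/-! ### Symmetry of past and future -/

section QTense

variable {M : Type u} [MVAlgebra M] {G H : M → M}

theorem IsQTense.symm (h : IsQTense G H) : IsQTense H G where
  galois x y := by
    have := h.galois (neg y) (neg x)
    simp only [dual, MVAlgebra.neg_neg] at this ⊢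
    rw [neg_le_comm', ← this, neg_le_neg_iff']
  map_q_left := dual_q h.map_d_right
  map_d_left := dual_d h.map_q_right
  map_q_right := by
    have := dual_q h.map_d_left
    rwa [dual_dual] at this
  map_d_right := by
    have := dual_d h.map_q_left
    rwa [dual_dual] at this

theorem frame_isTense {T : Type u} (R : T → T → Prop) : IsTense (frameG R) (frameH R) where
  G_one := frameG_one R
  H_one := frameG_one _
  G_imp := frameG_imp R
  H_imp := frameG_imp _
  G_oplus := frameG_oplus R
  H_oplus := frameG_oplus _
  G_double x := (frameG_q R x).le
  H_double x := (frameG_q _ x).le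
  F_double x := (dual_q (frameG_d R) x).ge
  P_double x := (dual_q (K := frameH R) (frameG_d _) x).ge
  le_G_P x := (frame_isQTense R).galois.le_u_l x
  le_H_F x := (frame_isQTense R).symm.galois.le_u_l x

theorem relG_converse (h : IsQTense G H) {s t : standardMorphisms M} (hst : relG G s t) :
    relG H t s := by
  intro x
  have ht : IsMVMorphism t.1 := t.2
  have hs : IsMVMorphism s.1 := s.2
  -- As `H x = ¬ P (¬ x)`, the claim follows from `¬ x ≤ G (P (¬ x))` and `s R_G t` at `P (¬ x)`.
  have h1 : s.1 (neg x) ≤ t.1 (dual H (neg x)) :=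
    (hs.monotone (h.galois.le_u_l (neg x))).trans (hst _)
  simp only [dual, MVAlgebra.neg_neg, hs.map_neg, ht.map_neg] at h1
  exact neg_le_neg_iff'.1 h1

theorem relG_eq_converse (h : IsQTense G H) :
    relG H = fun s t : standardMorphisms M => relG G t s := by
  funext s t
  exact propext ⟨relG_converse h.symm, relG_converse h⟩

/-! ### The canonical embedding -/

theorem IsQTense.isSemistate {S₀ : Set (M → I)} (hS : IsOrderReflecting S₀) (h : IsQTense G H)
    {s : M → I} (hs : IsMVMorphism s) : IsSemistate fun x => s (G x) where
  monotone := hs.monotone.comp h.galois.monotone_u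
  map_one := by
    have h1 : G one = one := le_antisymm (le_one' _) (h.galois.le_u (le_one' _))
    rw [h1, hs.map_one, one_eq]
  min_le_meet x y := by
    have hle : meet (G x) (G y) ≤ G (meet x y) :=
      h.galois.le_u (hS.le_meet (h.galois.l_le (hS.meet_le_left _ _))
        (h.galois.l_le (hS.meet_le_right _ _)))
    rw [← meet_eq_min, ← hs.map_meet]
    exact hs.monotone hle
  map_q x := by rw [h.map_q_right, hs.map_q]
  map_d x := by rw [h.map_d_right, hs.map_d]

theorem evalMap_G {S₀ : Set (M → I)} (hS : IsOrderReflecting S₀) (h : IsQTense G H) (x : M) :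
    evalMap M (G x) = frameG (relG G) (evalMap M x) := by
  funext s
  refine le_antisymm (le_frameG _ fun t ht => ht x) ?_
  refine le_of_forall_gt_imp_ge_of_dense fun r hr => ?_
  obtain ⟨t, ht, hst, htx⟩ := (h.isSemistate hS s.2).exists_morphism hS hr
  exact (frameG_le (relG G) (t := ⟨t, ht⟩) hst).trans htx

theorem evalMap_isMVMorphism : IsMVMorphism (evalMap M) where
  map_oplus x y := funext fun s => IsMVMorphism.map_oplus s.2 x y
  map_neg x := funext fun s => IsMVMorphism.map_neg s.2 x
  map_zero := funext fun s => IsMVMorphism.map_zero s.2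

theorem evalMap_le_iff {S₀ : Set (M → I)} (hS : IsOrderReflecting S₀) (a b : M) :
    evalMap M a ≤ evalMap M b ↔ a ≤ b :=
  ⟨fun h => hS.reflects a b fun s hs => h ⟨s, hS.morphism hs⟩,
    fun h => evalMap_isMVMorphism.monotone h⟩

theorem evalMap_isTenseEmbedding {S₀ : Set (M → I)} (hS : IsOrderReflecting S₀)
    (h : IsQTense G H) :
    IsTenseEmbedding G H (frameG (relG G)) (frameH (relG G)) (evalMap M) where
  morphism := evalMap_isMVMorphism
  injective a b hab :=
    le_antisymm ((evalMap_le_iff hS a b).1 hab.le) ((evalMap_le_iff hS b a).1 hab.ge)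
  le_iff_le := evalMap_le_iff hS
  map_G := evalMap_G hS h
  map_H x := by
    rw [evalMap_G hS h.symm, relG_eq_converse h]
    rfl

theorem IsTenseEmbedding.isTense {N : Type v} [MVAlgebra N] {G' H' : N → N} {e : M → N}
    (he : IsTenseEmbedding G H G' H' e) (h : IsTense G' H') : IsTense G H where
  G_one := he.injective (by simp only [he.map_G, he.morphism.map_one, h.G_one])
  H_one := he.injective (by simp only [he.map_H, he.morphism.map_one, h.H_one])
  G_imp x y := (he.le_iff_le _ _).1 (by
    simpa only [he.map_G, he.morphism.map_imp] using h.G_imp (e x) (e y))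
  H_imp x y := (he.le_iff_le _ _).1 (by
    simpa only [he.map_H, he.morphism.map_imp] using h.H_imp (e x) (e y))
  G_oplus x y := (he.le_iff_le _ _).1 (by
    simpa only [he.map_G, he.morphism.map_oplus] using h.G_oplus (e x) (e y))
  H_oplus x y := (he.le_iff_le _ _).1 (by
    simpa only [he.map_H, he.morphism.map_oplus] using h.H_oplus (e x) (e y))
  G_double x := (he.le_iff_le _ _).1 (by
    simpa only [he.map_G, he.morphism.map_oplus] using h.G_double (e x))
  H_double x := (he.le_iff_le _ _).1 (by
    simpa only [he.map_H, he.morphism.map_oplus] using h.H_double (e x))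
  F_double x := (he.le_iff_le _ _).1 (by
    simpa only [dual, he.map_G, he.morphism.map_neg, he.morphism.map_oplus]
      using h.F_double (e x))
  P_double x := (he.le_iff_le _ _).1 (by
    simpa only [dual, he.map_H, he.morphism.map_neg, he.morphism.map_oplus]
      using h.P_double (e x))
  le_G_P x := (he.le_iff_le _ _).1 (by
    simpa only [dual, he.map_G, he.map_H, he.morphism.map_neg] using h.le_G_P (e x))
  le_H_F x := (he.le_iff_le _ _).1 (by
    simpa only [dual, he.map_G, he.map_H, he.morphism.map_neg] using h.le_H_F (e x))

theorem standardMorphisms_nonempty {S₀ : Set (M → I)} (hS : IsOrderReflecting S₀)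
    (h : (zero : M) ≠ one) : (standardMorphisms M).Nonempty := by
  by_contra hne
  have hle : ∀ a b : M, a ≤ b := fun a b =>
    hS.reflects a b fun s hs => absurd ⟨s, hS.morphism hs⟩ hne
  exact h (le_antisymm (hle _ _) (hle _ _))

end QTense

theorem corollary7 {M : Type*} [MVAlgebra M]
    (S₀ : Set (M → unitInterval)) (hS₀ : IsOrderReflecting S₀)
    (G H : M → M) (hGH : IsQTense G H) :
    ((MVAlgebra.zero : M) ≠ MVAlgebra.one → (standardMorphisms M).Nonempty) ∧
    IsQTense (frameG (relG G)) (frameH (relG G)) ∧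
    IsTense (frameG (relG G)) (frameH (relG G)) ∧
    IsTenseEmbedding G H (frameG (relG G)) (frameH (relG G)) (evalMap M) ∧
    IsTense G H :=
  ⟨standardMorphisms_nonempty hS₀, frame_isQTense _, frame_isTense _,
    evalMap_isTenseEmbedding hS₀ hGH, (evalMap_isTenseEmbedding hS₀ hGH).isTense (frame_isTense _)⟩
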